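/- Let $(\mathcal B,\otimes,\mathbb 1)$ be a braided monoidal category with braiding $\tau_{X,Y}\colon X\otimes Y\to Y\otimes X$, and let $(H,m,u,\Delta,\varepsilon,S)$ be a Hopf algebra in $\mathcal B$ with invertible antipode $S$. Let $(\delta,\sigma)$ be a modular pair for $H$, that is, $\delta\colon H\to\mathbb 1$ is an algebra morphism and $\sigma\colon\mathbb 1\to H$ is a coalgebra morphism such that $\delta\sigma=\mathrm{id}_{\mathbb 1}$. (Associativity and unit constraints are suppressed below.) Let $\tilde S=S(\delta\otimes\mathrm{id}_H)\Delta\colon H\to H$, and let $a_n\colon H\otimes H^{\otimes n}\to H^{\otimes n}$ be the left diagonal action, defined by $a_0=\varepsilon$ and $a_{n}=(m\otimes a_{n-1})(\mathrm{id}_H\otimes\tau_{H,H}\otimes\mathrm{id}_{H^{\otimes n-1}})(\Delta\otimes\mathrm{id}_{H^{\otimes n}})$ for $n\ge1$. The object $\mathbf{CM}_\bullet(H,\delta,\sigma)$ of Khalkhali and Pourkia consists of the objects $\mathbf{CM}_n=H^{\otimes n}$ ($n\ge 0$) with * the cofaces $\delta_i^n\colon H^{\otimes n-1}\to H^{\otimes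 n}$ ($n\ge1$, $0\le i\le n$), where $\delta_0^n=u\otimes\mathrm{id}_{H^{\otimes n-1}}$, $\delta_i^n=\mathrm{id}_{H^{\otimes i-1}}\otimes\Delta\otimes\mathrm{id}_{H^{\otimes n-1-i}}$ for $1\le i\le n-1$, and $\delta_n^n=\mathrm{id}_{H^{\otimes n-1}}\otimes\sigma$; * the codegeneracies $\sigma_j^n=\mathrm{id}_{H^{\otimes j}}\otimes\varepsilon\otimes\mathrm{id}_{H^{\otimes n-j}}\colon H^{\otimes n+1}\to H^{\otimes n}$ ($n\ge0$, $0\le j\le n$); * the operators $\tau_n=\tau_n(\delta,\sigma)\colon H^{\otimes n}\to H^{\otimes n}$, where $\tau_0=\mathrm{id}_{\mathbb 1}$ and $\tau_n=a_n(\tilde S\otimes\mathrm{id}_{H^{\otimes n-1}}\otimes\sigma)$ for $n\ge1$. Then $\mathbf{CM}_\bullet(H,\delta,\sigma)$ is a paracocyclic object in $\mathcal B$. That is, every $\tau_n$ is an isomorphism, the simplicial relations $$\delta_j\delta_i=\delta_i\delta_{j-1}\ (i<j),\qquad \sigma_j\sigma_i=\sigma_i\sigma_{j+1}\ (i\le j),\qquad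 \sigma_j\delta_i=\begin{cases}\delta_i\sigma_{j-1}& i<j,\\ \mathrm{id}& i=j \text{ or } i=j+1,\\ \delta_{i-1}\sigma_j& i>j+1\end{cases}$$ hold (in all degrees and for all indices for which they make sense), and so do the paracyclic compatibility relations $$\tau_n\delta_i^n=\delta_{i-1}^n\tau_{n-1}\ (n\ge 1,\ 1\le i\le n),\qquad \tau_n\delta_0^n=\delta_n^n\ (n\ge1),$$ $$\tau_n\sigma_i^n=\sigma_{i-1}^n\tau_{n+1}\ (1\le i\le n),\qquad \tau_n\sigma_0^n=\sigma_n^n\tau_{n+1}^2\ (n\ge0).$$ -/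

import Mathlib

open CategoryTheory MonoidalCategory
open scoped MonObj ComonObj HopfObj

universe v u

namespace BraidedCM

/-! ### Paracocyclic objects -/

/-- The data underlying a paracocyclic object: a sequence of objects, the cofaces
`δ_i^{n+1} : X_n ⟶ X_{n+1}` for `0 ≤ i ≤ n + 1`, the codegeneracies
`σ_j^n : X_{n+1} ⟶ X_n` for `0 ≤ j ≤ n`, and endomorphisms `τ_n : X_n ⟶ X_n`.
No relation is imposed here, see `IsParacocyclic`. -/
structure ParacocyclicData (C : Type u) [Category.{v} C] where
  obj : ℕ → C
  coface : (n : ℕ) → Fin (n + 2) → (obj n ⟶ obj (n + 1))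
  codegen : (n : ℕ) → Fin (n + 1) → (obj (n + 1) ⟶ obj n)
  cyc : (n : ℕ) → (obj n ⟶ obj n)

/-- The data form a paracocyclic object: the `τ_n` are isomorphisms, and the simplicial relations
and the paracyclic compatibility relations hold. (`f ≫ g` is the composite `g ∘ f`.) -/
structure IsParacocyclic {C : Type u} [Category.{v} C] (X : ParacocyclicData C) : Prop where
  /-- `τ_n` is invertible -/
  cyc_isIso : ∀ n : ℕ, IsIso (X.cyc n)
  /-- `δ_{j+1} δ_i = δ_i δ_j` for `i ≤ j` -/
  coface_coface : ∀ (n : ℕ) (i j : Fin (n + 2)), i ≤ j →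
    X.coface n i ≫ X.coface (n + 1) j.succ = X.coface n j ≫ X.coface (n + 1) i.castSucc
  /-- `σ_j σ_i = σ_i σ_{j+1}` for `i ≤ j` -/
  codegen_codegen : ∀ (n : ℕ) (i j : Fin (n + 1)), i ≤ j →
    X.codegen (n + 1) i.castSucc ≫ X.codegen n j = X.codegen (n + 1) j.succ ≫ X.codegen n i
  /-- `σ_{j+1} δ_i = δ_i σ_j` for `i ≤ j` -/
  coface_codegen_of_le : ∀ (n : ℕ) (i : Fin (n + 2)) (j : Fin (n + 1)), i ≤ j.castSucc →
    X.coface (n + 1) i.castSucc ≫ X.codegen (n + 1) j.succ = X.codegen n j ≫ X.coface n i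
  /-- `σ_j δ_j = id` -/
  coface_codegen_self : ∀ (n : ℕ) (j : Fin (n + 1)),
    X.coface n j.castSucc ≫ X.codegen n j = 𝟙 (X.obj n)
  /-- `σ_j δ_{j+1} = id` -/
  coface_codegen_succ : ∀ (n : ℕ) (j : Fin (n + 1)),
    X.coface n j.succ ≫ X.codegen n j = 𝟙 (X.obj n)
  /-- `σ_j δ_{i+1} = δ_i σ_j` for `i > j` -/
  coface_codegen_of_gt : ∀ (n : ℕ) (i : Fin (n + 2)) (j : Fin (n + 1)), j.castSucc < i →
    X.coface (n + 1) i.succ ≫ X.codegen (n + 1) j.castSucc = X.codegen n j ≫ X.coface n i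
  /-- `τ_{n+1} δ_{i+1} = δ_i τ_n` for `0 ≤ i ≤ n` -/
  coface_succ_cyc : ∀ (n : ℕ) (i : Fin (n + 1)),
    X.coface n i.succ ≫ X.cyc (n + 1) = X.cyc n ≫ X.coface n i.castSucc
  /-- `τ_{n+1} δ_0 = δ_{n+1}` -/
  coface_zero_cyc : ∀ n : ℕ, X.coface n 0 ≫ X.cyc (n + 1) = X.coface n (Fin.last (n + 1))
  /-- `τ_n σ_{i+1} = σ_i τ_{n+1}` for `0 ≤ i < n` -/
  codegen_succ_cyc : ∀ (n : ℕ) (i : Fin n),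
    X.codegen n i.succ ≫ X.cyc n = X.cyc (n + 1) ≫ X.codegen n i.castSucc
  /-- `τ_n σ_0 = σ_n τ_{n+1}^2` -/
  codegen_zero_cyc : ∀ n : ℕ,
    X.codegen n 0 ≫ X.cyc n = X.cyc (n + 1) ≫ X.cyc (n + 1) ≫ X.codegen n (Fin.last n)

/-! ### Modular pairs -/

section Pairs

attribute [local instance] MonObj.instTensorUnit ComonObj.instTensorUnit

/-- A modular pair for `H`: an algebra morphism `δ : H ⟶ 𝟙` and a coalgebra morphism
`σ : 𝟙 ⟶ H` whose composite `δ ∘ σ` is the identity of the unit object. -/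
structure ModularPair {C : Type u} [Category.{v} C] [MonoidalCategory C] [BraidedCategory C]
    (H : C) [HopfObj H] where
  δ : H ⟶ 𝟙_ C
  σ : 𝟙_ C ⟶ H
  isMonHom_δ : IsMonHom δ
  isComonHom_σ : IsComonHom σ
  σ_δ : σ ≫ δ = 𝟙 (𝟙_ C)

end Pairs

/-! ### The construction -/

section Construction

variable {C : Type u} [Category.{v} C] [MonoidalCategory C]

/-- The tensor power `H^{⊗ n}`, with `H^{⊗ 0} = 𝟙` and `H^{⊗ (n+1)} = H ⊗ H^{⊗ n}`. -/
def tpow (H : C) : ℕ → C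
  | 0 => 𝟙_ C
  | n + 1 => H ⊗ tpow H n

/-- The morphism `id ⊗ s : H^{⊗ n} ⟶ H^{⊗ (n+1)}` that inserts `s : 𝟙 ⟶ H` as the last factor. -/
def insertLast {H : C} (s : 𝟙_ C ⟶ H) : (n : ℕ) → (tpow H n ⟶ tpow H (n + 1))
  | 0 => s ≫ (ρ_ H).inv
  | n + 1 => H ◁ insertLast s n

/-- The morphism `u ⊗ id : H^{⊗ n} ⟶ H^{⊗ (n+1)}` that inserts the unit as the first factor. -/
def insertUnit (H : C) [MonObj H] (n : ℕ) : tpow H n ⟶ tpow H (n + 1) :=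
  (λ_ (tpow H n)).inv ≫ η[H] ▷ tpow H n

/-- The comultiplication applied to the tensor factor with index `i` (counted from `0`). -/
def comulAt (H : C) [ComonObj H] : (n : ℕ) → Fin n → (tpow H n ⟶ tpow H (n + 1))
  | 0, i => i.elim0
  | n + 1, i => Fin.cases (Δ[H] ▷ tpow H n ≫ (α_ H H (tpow H n)).hom)
      (fun k => H ◁ comulAt H n k) i

/-- The counit applied to the tensor factor with index `j` (counted from `0`). -/
def counitAt (H : C) [ComonObj H] : (n : ℕ) → Fin (n + 1) → (tpow H (n + 1) ⟶ tpow H n)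
  | 0, _ => ε[H] ▷ 𝟙_ C ≫ (λ_ (𝟙_ C)).hom
  | n + 1, j => Fin.cases (ε[H] ▷ tpow H (n + 1) ≫ (λ_ (tpow H (n + 1))).hom)
      (fun k => H ◁ counitAt H n k) j

/-- The cofaces `δ_i : H^{⊗ n} ⟶ H^{⊗ (n+1)}`, `0 ≤ i ≤ n + 1`: the unit is inserted on the left
for `i = 0`, the `i`-th factor (counted from `1`) is comultiplied for `1 ≤ i ≤ n`, and `s` is
inserted on the right for `i = n + 1`. -/
def coface {H : C} [MonObj H] [ComonObj H] (s : 𝟙_ C ⟶ H) (n : ℕ) (i : Fin (n + 2)) :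
    tpow H n ⟶ tpow H (n + 1) :=
  Fin.cases (insertUnit H n)
    (fun k : Fin (n + 1) =>
      Fin.lastCases (motive := fun _ => tpow H n ⟶ tpow H (n + 1))
        (insertLast s n) (fun l : Fin n => comulAt H n l) k) i

variable [BraidedCategory C]

/-- The left diagonal action `H ⊗ H^{⊗ n} ⟶ H^{⊗ n}`: the counit for `n = 0`, and
`(m ⊗ act_n) ∘ (id ⊗ braiding ⊗ id) ∘ (Δ ⊗ id)` on `H ⊗ (H ⊗ H^{⊗ n})`, where the braiding is that
of the acting second leg of `Δ` past the first factor `H`. -/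
def diagAct (H : C) [BimonObj H] : (n : ℕ) → (H ⊗ tpow H n ⟶ tpow H n)
  | 0 => (ρ_ H).hom ≫ ε[H]
  | n + 1 => Δ[H] ▷ (H ⊗ tpow H n) ≫ tensorμ H H H (tpow H n) ≫ (μ[H] ⊗ₘ diagAct H n)

/-- The twisted antipode `(δ ⊗ S) ∘ Δ : H ⟶ H`. -/
def twistedAntipode {H : C} [HopfObj H] (d : H ⟶ 𝟙_ C) : H ⟶ H :=
  Δ[H] ≫ d ▷ H ≫ (λ_ H).hom ≫ 𝒮[H]

/-- The paracocyclic operator `τ_n : H^{⊗ n} ⟶ H^{⊗ n}`: the identity for `n = 0`, and otherwise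
the twisted antipode of the first factor acts diagonally on the remaining factors followed
by `s`. -/
def cyc {H : C} [HopfObj H] (d : H ⟶ 𝟙_ C) (s : 𝟙_ C ⟶ H) : (n : ℕ) → (tpow H n ⟶ tpow H n)
  | 0 => 𝟙 (𝟙_ C)
  | n + 1 => (twistedAntipode d ⊗ₘ insertLast s n) ≫ diagAct H (n + 1)

/-- The family `CM_•(H, δ, σ)`, with `CM_n = H^{⊗ n}`. -/
def CM (H : C) [HopfObj H] (p : ModularPair H) : ParacocyclicData C where
  obj := tpow H
  coface := coface p.σ
  codegen := counitAt H
  cyc := cyc p.δ p.σ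

end Construction

end BraidedCM

/-! With elements, and crossings suppressed, τ_{n+1}(x ⊗ y) = S̃(x)·(y ⊗ σ) for the diagonal action.
Since H^{⊗(n+1)} is H ⊗ H^{⊗n} with the tensor product action (`tensAct`), each relation is either
an induction on the number of factors or a fact about the operator x ⊗ y ↦ S̃(x)·t(y) for a map t
into an object with an action (`twistedAct`).

Comultiplying or counting out one factor is H-linear, so away from the first factor the relations
follow from `twistedAct_naturality`. At the first factor they rest on S̃(1) = 1 and two
computations. `comul_twistedAct`: S̃(x₁)·(x₂ ⊗ y) = 1 ⊗ S̃(x)·y, because S̃ reverses Δ.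
`twistedAct_twistedAct`: S̃(h₁x)·(h₂·y) = δ(h) S̃(x)·y, because S̃ reverses products, and then h =
S̃(x') turns δ(h) into ε(x').

For invertibility, `whiskerLeft_insert_tensAct` factors τ_{n+1}, up to reassociation, into five
maps: the twist by δ, a shear, S, a braiding and right multiplication by σ. Only the factor S needs
the antipode to be invertible. The condition δσ = id is needed only for the relations involving τ_0.
-/

namespace BraidedCM

/-! ### Coherence for the middle interchange of strands. -/

section Strands

variable {C : Type u} [Category.{v} C] [MonoidalCategory C]

lemma comp_tensorHom {A A' A'' B B' : C} (f : A ⟶ A') (g : A' ⟶ A'') (h : B ⟶ B') :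
    (f ≫ g) ⊗ₘ h = f ▷ B ≫ (g ⊗ₘ h) := by
  simp [MonoidalCategory.tensorHom_def]

lemma tensorHom_comp {A A' B B' B'' : C} (h : A ⟶ A') (f : B ⟶ B') (g : B' ⟶ B'') :
    h ⊗ₘ (f ≫ g) = A ◁ f ≫ (h ⊗ₘ g) := by
  simp [tensorHom_def']

variable [BraidedCategory C]

/-- By the hexagon, A crossing B and then Y is one crossing past B ⊗ Y, so a morphism out of B ⊗ Y
can slide through it. -/
lemma braiding_whiskerRight_tensorμ (A B Y Z : C) :
    (β_ A B).hom ▷ (Y ⊗ Z) ≫ tensorμ B A Y Z =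
      (α_ A B (Y ⊗ Z)).hom ≫ A ◁ (α_ B Y Z).inv ≫ (α_ A (B ⊗ Y) Z).inv ≫
        (β_ A (B ⊗ Y)).hom ▷ Z ≫ (α_ (B ⊗ Y) A Z).hom := by
  simp only [tensorμ, BraidedCategory.braiding_tensor_right_hom, comp_whiskerRight]
  monoidal

/-- The companion hexagon: B and then A crossing Y is one crossing of A ⊗ B past Y. -/
lemma tensorμ_braiding_whiskerRight (A B Y Z : C) :
    tensorμ A B Y Z ≫ (β_ A Y).hom ▷ (B ⊗ Z) =
      (α_ (A ⊗ B) Y Z).inv ≫ (β_ (A ⊗ B) Y).hom ▷ Z ≫ (α_ Y (A ⊗ B) Z).hom ≫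
        Y ◁ (α_ A B Z).hom ≫ (α_ Y A (B ⊗ Z)).inv := by
  simp only [tensorμ, BraidedCategory.braiding_tensor_left_hom, comp_whiskerRight]
  monoidal

lemma tensorμ_unit_right (A B Y : C) :
    (A ⊗ B) ◁ (ρ_ Y).inv ≫ tensorμ A B Y (𝟙_ C) =
      (α_ A B Y).hom ≫ A ◁ (β_ B Y).hom ≫ (α_ A Y B).inv ≫ (A ⊗ Y) ◁ (ρ_ B).inv := by
  simp only [tensorμ]
  monoidal

lemma tensorμ_unit_middle (A B Y : C) :
    tensorμ A B (𝟙_ C) Y ≫ (ρ_ A).hom ▷ (B ⊗ Y) = (A ⊗ B) ◁ (λ_ Y).hom ≫ (α_ A B Y).hom := by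
  simp only [tensorμ, braiding_tensorUnit_right]
  monoidal

end Strands

/-! ### Tensor products of actions of a bialgebra. -/

section Actions

variable {C : Type u} [Category.{v} C] [MonoidalCategory C] [BraidedCategory C]

/-- The diagonal action on the tensor product of two objects with an action of `H`. -/
def tensAct {H : C} [BimonObj H] {X Y : C} (a : H ⊗ X ⟶ X) (b : H ⊗ Y ⟶ Y) :
    H ⊗ (X ⊗ Y) ⟶ X ⊗ Y :=
  Δ[H] ▷ (X ⊗ Y) ≫ tensorμ H H X Y ≫ (a ⊗ₘ b)

variable {H : C} [BimonObj H] {X Y Z X' Y' : C}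

lemma tensorHom_tensAct (a : H ⊗ X ⟶ X) (b : H ⊗ Y ⟶ Y) (a' : H ⊗ X' ⟶ X') (b' : H ⊗ Y' ⟶ Y')
    (f : X ⟶ X') (g : Y ⟶ Y') (hf : H ◁ f ≫ a' = a ≫ f) (hg : H ◁ g ≫ b' = b ≫ g) :
    H ◁ (f ⊗ₘ g) ≫ tensAct a' b' = tensAct a b ≫ (f ⊗ₘ g) := by
  simp only [tensAct, Category.assoc]
  rw [whisker_exchange_assoc, tensorμ_natural_right_assoc, tensorHom_comp_tensorHom,
    tensorHom_comp_tensorHom, hf, hg]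

lemma whiskerLeft_tensAct (a : H ⊗ X ⟶ X) (b : H ⊗ Y ⟶ Y) (b' : H ⊗ Y' ⟶ Y')
    (g : Y ⟶ Y') (hg : H ◁ g ≫ b' = b ≫ g) :
    H ◁ X ◁ g ≫ tensAct a b' = tensAct a b ≫ X ◁ g := by
  simpa using tensorHom_tensAct a b a b' (𝟙 X) g (by simp) hg

lemma whiskerRight_tensAct (a : H ⊗ X ⟶ X) (b : H ⊗ Y ⟶ Y) (a' : H ⊗ X' ⟶ X')
    (f : X ⟶ X') (hf : H ◁ f ≫ a' = a ≫ f) :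
    H ◁ f ▷ Y ≫ tensAct a' b = tensAct a b ≫ f ▷ Y := by
  simpa using tensorHom_tensAct a b a' b f (𝟙 Y) hf (by simp)

/-- Coassociativity, together with the coherence of the interchange with associators. -/
lemma associator_tensAct (a : H ⊗ X ⟶ X) (b : H ⊗ Y ⟶ Y) (c : H ⊗ Z ⟶ Z) :
    H ◁ (α_ X Y Z).hom ≫ tensAct a (tensAct b c) =
      tensAct (tensAct a b) c ≫ (α_ X Y Z).hom := by
  have h₁ : tensAct (tensAct a b) c = Δ[H] ▷ _ ≫ (Δ[H] ▷ H) ▷ _ ≫ tensorμ (H ⊗ H) H (X ⊗ Y) Z ≫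
      tensorμ H H X Y ▷ (H ⊗ Z) ≫ ((a ⊗ₘ b) ⊗ₘ c) := by
    have := tensorμ_natural_left Δ[H] (𝟙 H) (X ⊗ Y) Z
    simp only [tensorHom_id, id_whiskerRight] at this
    simp only [tensAct, reassoc_of% this, comp_tensorHom]
  have h₂ : tensAct a (tensAct b c) = Δ[H] ▷ _ ≫ (H ◁ Δ[H]) ▷ _ ≫ tensorμ H (H ⊗ H) X (Y ⊗ Z) ≫
      (H ⊗ X) ◁ tensorμ H H Y Z ≫ (a ⊗ₘ b ⊗ₘ c) := by
    have := tensorμ_natural_left (𝟙 H) Δ[H] X (Y ⊗ Z)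
    simp only [id_tensorHom, id_whiskerRight] at this
    simp only [tensAct, reassoc_of% this, tensorHom_comp]
  rw [h₁, h₂]
  simp only [Category.assoc]
  rw [associator_naturality, associator_monoidal_assoc, whisker_exchange_assoc,
    MonoidalCategory.tensorHom_def (α_ H H H).hom, Category.assoc, whisker_exchange_assoc]
  simp only [← comp_whiskerRight_assoc, ComonObj.comul_assoc]

/-- The bialgebra axiom, read as H-linearity of Δ; it makes the inner cofaces equivariant. -/
lemma comul_tensAct : H ◁ Δ[H] ≫ tensAct μ[H] μ[H] = μ[H] ≫ Δ[H] := by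
  rw [BimonObj.mul_comul, tensAct, whisker_exchange_assoc, tensorHom_def_assoc]

lemma leftUnitor_tensAct (b : H ⊗ Y ⟶ Y) :
    H ◁ (λ_ Y).hom ≫ b = tensAct ((ρ_ H).hom ≫ ε[H]) b ≫ (λ_ Y).hom := by
  simp only [tensAct, Category.assoc]
  rw [MonoidalCategory.tensorHom_def, Category.assoc, comp_whiskerRight, Category.assoc,
    reassoc_of% tensorμ_unit_middle, ← whisker_exchange_assoc, leftUnitor_naturality]
  have h : Δ[H] ▷ Y ≫ (α_ H H Y).hom ≫ ε[H] ▷ (H ⊗ Y) ≫ (λ_ (H ⊗ Y)).hom = 𝟙 _ := by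
    rw [← associator_naturality_left_assoc, ← comp_whiskerRight_assoc, ComonObj.counit_comul]
    monoidal
  rw [reassoc_of% h]

lemma rightUnitor_tensAct (b : H ⊗ Y ⟶ Y) :
    H ◁ (ρ_ Y).hom ≫ b = tensAct b ((ρ_ H).hom ≫ ε[H]) ≫ (ρ_ Y).hom := by
  rw [← cancel_epi (H ◁ (ρ_ Y).inv), whiskerLeft_inv_hom_assoc]
  simp only [tensAct, Category.assoc]
  rw [whisker_exchange_assoc, reassoc_of% tensorμ_unit_right, tensorHom_def'_assoc]
  have h : Δ[H] ▷ Y ≫ (α_ H H Y).hom ≫ H ◁ (β_ H Y).hom ≫ (α_ H Y H).inv ≫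
      (H ⊗ Y) ◁ ε[H] ≫ (ρ_ (H ⊗ Y)).hom = 𝟙 _ := by
    rw [← associator_inv_naturality_right_assoc, ← whiskerLeft_comp_assoc,
      ← BraidedCategory.braiding_naturality_left, whiskerLeft_comp_assoc,
      ← associator_naturality_middle_assoc, ← comp_whiskerRight_assoc, ComonObj.comul_counit]
    simp only [braiding_tensorUnit_left]
    monoidal
  rw [rightUnitor_naturality, whiskerLeft_comp_assoc, ← whiskerLeft_comp_assoc, Iso.inv_hom_id,
    whiskerLeft_id, Category.id_comp, reassoc_of% h]

lemma counit_equivariant : H ◁ ε[H] ≫ (ρ_ H).hom ≫ ε[H] = μ[H] ≫ ε[H] := by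
  rw [Bimon.mul_counit]
  simp [tensorHom_def', unitors_equal]

lemma one_tensAct (a : H ⊗ X ⟶ X) (b : H ⊗ Y ⟶ Y) (ha : η[H] ▷ X ≫ a = (λ_ X).hom)
    (hb : η[H] ▷ Y ≫ b = (λ_ Y).hom) :
    η[H] ▷ (X ⊗ Y) ≫ tensAct a b = (λ_ (X ⊗ Y)).hom := by
  rw [tensAct, ← comp_whiskerRight_assoc, Bimon.one_comul, tensor_left_unitality,
    comp_whiskerRight_assoc, tensorμ_natural_left_assoc, tensorHom_comp_tensorHom, ha, hb]

/-- Associativity of the tensor product action comes from multiplicativity of Δ and naturality of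
the interchange. -/
lemma mul_tensAct (a : H ⊗ X ⟶ X) (b : H ⊗ Y ⟶ Y)
    (ha : μ[H] ▷ X ≫ a = (α_ H H X).hom ≫ H ◁ a ≫ a)
    (hb : μ[H] ▷ Y ≫ b = (α_ H H Y).hom ≫ H ◁ b ≫ b) :
    μ[H] ▷ (X ⊗ Y) ≫ tensAct a b =
      (α_ H H (X ⊗ Y)).hom ≫ H ◁ tensAct a b ≫ tensAct a b := by
  simp only [tensAct]
  rw [← comp_whiskerRight_assoc, BimonObj.mul_comul]
  simp only [comp_whiskerRight, Category.assoc]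
  have h₁ := tensorμ_natural_left μ[H] μ[H] X Y
  have h₂ := tensorμ_natural_right H H a b
  simp only [reassoc_of% h₁, tensorHom_comp_tensorHom, ha, hb]
  rw [← tensorHom_comp_tensorHom, tensor_associativity_assoc, ← tensorHom_comp_tensorHom,
    MonoidalCategory.tensorHom_def]
  simp only [comp_whiskerRight, whiskerLeft_comp, Category.assoc, whisker_exchange_assoc,
    reassoc_of% h₂]
  rw [associator_naturality_middle_assoc, associator_naturality_left_assoc]

end Actions

/-! ### Convolution by a functional. -/

section Twist

variable {C : Type u} [Category.{v} C] [MonoidalCategory C]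

/-- The left convolution by a functional `d`, i.e. `(d ⊗ id) ∘ Δ`. -/
def twist {H : C} [ComonObj H] (d : H ⟶ 𝟙_ C) : H ⟶ H :=
  Δ[H] ≫ d ▷ H ≫ (λ_ H).hom

section Comon

variable {H : C} [ComonObj H]

lemma twist_counit (d : H ⟶ 𝟙_ C) : twist d ≫ ε[H] = d := by
  simp only [twist, Category.assoc]
  rw [← leftUnitor_naturality, ← whisker_exchange_assoc, ComonObj.comul_counit_assoc,
    ← rightUnitor_inv_naturality_assoc]
  simp [unitors_equal]

lemma twist_comul (d : H ⟶ 𝟙_ C) : twist d ≫ Δ[H] = Δ[H] ≫ twist d ▷ H := by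
  simp only [twist, Category.assoc, comp_whiskerRight]
  rw [← leftUnitor_naturality, ← whisker_exchange_assoc, ComonObj.comul_assoc_flip_assoc]
  monoidal

/-- The functional on the right is the convolution product e * d, so twists compose by convolution.
-/
lemma twist_twist (d e : H ⟶ 𝟙_ C) : twist e ≫ twist d = twist (twist e ≫ d) := by
  rw [twist.eq_def d, reassoc_of% twist_comul, ← comp_whiskerRight_assoc, twist.eq_def (_ ≫ d)]

lemma twist_ε : twist ε[H] = 𝟙 H := by
  simp [twist]

end Comon

variable [BraidedCategory C] {H : C}

lemma one_twist [BimonObj H] (d : H ⟶ 𝟙_ C) (hd : η[H] ≫ d = 𝟙 (𝟙_ C)) :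
    η[H] ≫ twist d = η[H] := by
  rw [twist, Bimon.one_comul_assoc, tensorHom_def'_assoc, ← comp_whiskerRight_assoc, hd]
  simp

lemma mul_twist [BimonObj H] (d : H ⟶ 𝟙_ C) (hd : μ[H] ≫ d = (d ⊗ₘ d) ≫ (λ_ (𝟙_ C)).hom) :
    μ[H] ≫ twist d = (twist d ⊗ₘ twist d) ≫ μ[H] := by
  have h₁ := tensorμ_natural d (𝟙 H) d (𝟙 H)
  have h₂ := leftUnitor_monoidal H H
  simp only [tensorHom_id, id_whiskerRight] at h₁
  simp only [twist, ← tensorHom_comp_tensorHom, Category.assoc]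
  simp only [h₂, reassoc_of% h₁, BimonObj.mul_comul_assoc, Category.assoc]
  rw [tensorHom_def'_assoc μ[H], ← comp_whiskerRight_assoc, hd]
  simp only [comp_whiskerRight, Category.assoc, whisker_exchange_assoc, leftUnitor_naturality]

end Twist

/-! ### The twisted antipode. -/

section Antipode

variable {C : Type u} [Category.{v} C] [MonoidalCategory C] [BraidedCategory C]
variable {H : C} [HopfObj H] {d : H ⟶ 𝟙_ C}

lemma twistedAntipode_eq : twistedAntipode d = twist d ≫ 𝒮[H] := by
  simp [twistedAntipode, twist]

lemma twistedAntipode_counit : twistedAntipode d ≫ ε[H] = d := by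
  simp [twistedAntipode_eq, twist_counit]

/-- S reverses Δ, and coassociativity puts the twist on the first leg of Δ, which ends up second. -/
lemma twistedAntipode_comul :
    twistedAntipode d ≫ Δ[H] = Δ[H] ≫ (β_ H H).hom ≫ (𝒮[H] ⊗ₘ twistedAntipode d) := by
  rw [twistedAntipode_eq, Category.assoc, HopfObj.antipode_comul, reassoc_of% twist_comul,
    BraidedCategory.braiding_naturality_left_assoc, tensorHom_comp]

lemma one_twistedAntipode (hd : η[H] ≫ d = 𝟙 (𝟙_ C)) : η[H] ≫ twistedAntipode d = η[H] := by
  rw [twistedAntipode_eq, ← Category.assoc, one_twist d hd, HopfObj.one_antipode]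

lemma mul_twistedAntipode (hd : μ[H] ≫ d = (d ⊗ₘ d) ≫ (λ_ (𝟙_ C)).hom) :
    μ[H] ≫ twistedAntipode d =
      (twistedAntipode d ⊗ₘ twistedAntipode d) ≫ (β_ H H).hom ≫ μ[H] := by
  rw [twistedAntipode_eq, ← Category.assoc, mul_twist d hd, Category.assoc, HopfObj.mul_antipode,
    ← tensorHom_comp_tensorHom]
  simp

/-- δ(x₁)δ(S x₂) = δ(x₁ S(x₂)) = ε(x), so δS is a convolution inverse of δ. -/
lemma twistedAntipode_self (hη : η[H] ≫ d = 𝟙 (𝟙_ C))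
    (hμ : μ[H] ≫ d = (d ⊗ₘ d) ≫ (λ_ (𝟙_ C)).hom) : twistedAntipode d ≫ d = ε[H] := by
  have h := HopfObj.antipode_right_assoc H d
  rw [hμ, hη, Category.comp_id] at h
  rw [← h]
  simp only [twistedAntipode, Category.assoc]
  rw [MonoidalCategory.tensorHom_def_assoc, whisker_exchange_assoc, leftUnitor_naturality,
    leftUnitor_naturality_assoc]

lemma comul_twistedAntipode_mul :
    Δ[H] ≫ twistedAntipode d ▷ H ≫ μ[H] = d ≫ η[H] := by
  rw [twistedAntipode_eq, comp_whiskerRight, Category.assoc, ← reassoc_of% twist_comul,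
    HopfObj.antipode_left, reassoc_of% twist_counit]

lemma isIso_twist (hη : η[H] ≫ d = 𝟙 (𝟙_ C))
    (hμ : μ[H] ≫ d = (d ⊗ₘ d) ≫ (λ_ (𝟙_ C)).hom) : IsIso (twist d) := by
  have h : twist (𝒮[H] ≫ d) ≫ d = ε[H] := by
    have h := HopfObj.antipode_left_assoc H d
    rw [hμ, hη, Category.comp_id] at h
    rw [← h]
    simp [twist, MonoidalCategory.tensorHom_def]
  refine ⟨twist (𝒮[H] ≫ d), ?_, ?_⟩
  · rw [twist_twist, ← Category.assoc, ← twistedAntipode_eq, twistedAntipode_self hη hμ, twist_ε]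
  · rw [twist_twist, h, twist_ε]

end Antipode

/-! ### The two antipode computations behind the cyclic relations. -/

section Operators

variable {C : Type u} [Category.{v} C] [MonoidalCategory C] [BraidedCategory C]
variable {H : C} [HopfObj H] {d : H ⟶ 𝟙_ C} {X : C} (a : H ⊗ X ⟶ X)

/-- S̃(x₁)·(x₂ ⊗ y) = S(x₂)x₃ ⊗ S̃(x₁)·y, and the antipode axiom collapses S(x₂)x₃ to the unit. -/
lemma comul_twistedAntipode_tensAct :
    Δ[H] ▷ X ≫ (α_ H H X).hom ≫ twistedAntipode d ▷ (H ⊗ X) ≫ tensAct μ[H] a =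
      twistedAntipode d ▷ X ≫ a ≫ (λ_ X).inv ≫ η[H] ▷ X := by
  simp only [tensAct]
  rw [← comp_whiskerRight_assoc, twistedAntipode_comul]
  simp only [comp_whiskerRight, Category.assoc]
  have h := tensorμ_natural_left 𝒮[H] (twistedAntipode d) H X
  rw [reassoc_of% h, reassoc_of% braiding_whiskerRight_tensorμ, tensorHom_comp_tensorHom]
  have hΔ : Δ[H] ▷ X ≫ (α_ H H X).hom ≫ Δ[H] ▷ (H ⊗ X) ≫ (α_ H H (H ⊗ X)).hom ≫
      H ◁ (α_ H H X).inv ≫ (α_ H (H ⊗ H) X).inv = (Δ[H] ≫ H ◁ Δ[H]) ▷ X := by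
    rw [ComonObj.comul_assoc]
    monoidal
  -- The whole factor S(x₂)x₃ is collapsed before the single crossing, which then only moves the
  -- unit.
  have hβ : Δ[H] ≫ H ◁ (Δ[H] ≫ 𝒮[H] ▷ H ≫ μ[H]) ≫ (β_ H H).hom = (λ_ H).inv ≫ η[H] ▷ H := by
    rw [HopfObj.antipode_left, whiskerLeft_comp_assoc, ComonObj.comul_counit_assoc,
      BraidedCategory.braiding_naturality_right]
    simp
  rw [MonoidalCategory.tensorHom_def, ← associator_naturality_left_assoc (𝒮[H] ▷ H ≫ μ[H]),
    ← comp_whiskerRight_assoc (β_ H (H ⊗ H)).hom, ← BraidedCategory.braiding_naturality_right,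
    reassoc_of% hΔ, ← comp_whiskerRight_assoc, Category.assoc, ← whiskerLeft_comp_assoc, hβ,
    comp_whiskerRight_assoc, associator_naturality_left_assoc, ← whisker_exchange]
  monoidal

/-- S̃(h₁x)·(h₂·y) = S̃(x)·(S̃(h₁)h₂·y) = δ(h) S̃(x)·y. -/
lemma tensAct_twistedAntipode (ha : μ[H] ▷ X ≫ a = (α_ H H X).hom ≫ H ◁ a ≫ a)
    (ha' : η[H] ▷ X ≫ a = (λ_ X).hom) (hμ : μ[H] ≫ d = (d ⊗ₘ d) ≫ (λ_ (𝟙_ C)).hom) :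
    tensAct μ[H] a ≫ twistedAntipode d ▷ X ≫ a =
      d ▷ (H ⊗ X) ≫ (λ_ (H ⊗ X)).hom ≫ twistedAntipode d ▷ X ≫ a := by
  have hS : (μ[H] ⊗ₘ a) ≫ twistedAntipode d ▷ X ≫ a =
      (β_ H H).hom ▷ (H ⊗ X) ≫ (α_ H H (H ⊗ X)).hom ≫ twistedAntipode d ▷ _ ≫
        H ◁ (twistedAntipode d ▷ (H ⊗ X) ≫ H ◁ a ≫ a) ≫ a := by
    rw [tensorHom_def'_assoc, ← comp_whiskerRight_assoc, mul_twistedAntipode hμ,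
      BraidedCategory.braiding_naturality_assoc]
    simp only [comp_whiskerRight, Category.assoc, ha, MonoidalCategory.tensorHom_def,
      whisker_exchange_assoc]
    monoidal
  have hβ : (β_ H H).hom ≫ H ◁ d = d ▷ H ≫ (λ_ H).hom ≫ (ρ_ H).inv := by
    rw [← BraidedCategory.braiding_naturality_left, braiding_tensorUnit_left]
  have hd : Δ[H] ▷ X ≫ (α_ H H X).hom ≫ twistedAntipode d ▷ (H ⊗ X) ≫ H ◁ a ≫ a =
      d ▷ X ≫ (λ_ X).hom := by
    rw [← associator_naturality_left_assoc, ← ha, ← comp_whiskerRight_assoc,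
      ← comp_whiskerRight_assoc, Category.assoc, comul_twistedAntipode_mul, comp_whiskerRight_assoc,
      ha']
  simp only [tensAct, Category.assoc]
  rw [hS, reassoc_of% tensorμ_braiding_whiskerRight, Iso.inv_hom_id_assoc,
    associator_inv_naturality_left_assoc, ← comp_whiskerRight_assoc,
    BraidedCategory.braiding_naturality_left, comp_whiskerRight_assoc,
    associator_naturality_middle_assoc, whisker_exchange_assoc, whisker_exchange_assoc]
  simp only [← whiskerLeft_comp_assoc, hd]
  rw [whiskerLeft_comp_assoc, ← whisker_exchange_assoc, ← associator_naturality_middle_assoc,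
    ← comp_whiskerRight_assoc, hβ]
  monoidal

end Operators

/-! ### Factorisation of the cyclic operator into invertible maps. -/

section Shear

variable {C : Type u} [Category.{v} C] [MonoidalCategory C]

/-- The endomorphism of `H ⊗ X` that splits the first factor by `f` and lets the second part
act on `X`. -/
def shear {H X : C} (f : H ⟶ H ⊗ H) (a : H ⊗ X ⟶ X) : H ⊗ X ⟶ H ⊗ X :=
  f ▷ X ≫ (α_ H H X).hom ≫ H ◁ a

/-- Associativity of the action merges the two acting legs, that of g multiplying that of f from the
left. -/
lemma shear_comp_shear {H X : C} [MonObj H] (f g : H ⟶ H ⊗ H) (a : H ⊗ X ⟶ X)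
    (ha : μ[H] ▷ X ≫ a = (α_ H H X).hom ≫ H ◁ a ≫ a) :
    shear f a ≫ shear g a = shear (f ≫ g ▷ H ≫ (α_ H H H).hom ≫ H ◁ μ[H]) a := by
  have h : shear (f ≫ g ▷ H ≫ (α_ H H H).hom ≫ H ◁ μ[H]) a =
      f ▷ X ≫ g ▷ H ▷ X ≫ (α_ H H H).hom ▷ X ≫ (α_ H (H ⊗ H) X).hom ≫ H ◁ (μ[H] ▷ X ≫ a) := by
    simp [shear]
  rw [h, ha]
  simp only [shear, Category.assoc]
  rw [whisker_exchange_assoc]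
  monoidal

lemma shear_unit {H X : C} [MonObj H] (a : H ⊗ X ⟶ X) (ha : η[H] ▷ X ≫ a = (λ_ X).hom) :
    shear ((ρ_ H).inv ≫ H ◁ η[H]) a = 𝟙 _ := by
  simp only [shear, comp_whiskerRight, Category.assoc]
  rw [associator_naturality_middle_assoc, ← whiskerLeft_comp, ha]
  monoidal

/-- Right multiplication by `s`. -/
def mulRight {H : C} [MonObj H] (s : 𝟙_ C ⟶ H) : H ⟶ H := (ρ_ H).inv ≫ H ◁ s ≫ μ[H]

lemma mulRight_comp {H : C} [MonObj H] (s t : 𝟙_ C ⟶ H) :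
    mulRight s ≫ mulRight t = mulRight ((λ_ (𝟙_ C)).inv ≫ (s ⊗ₘ t) ≫ μ[H]) := by
  simp only [mulRight, Category.assoc]
  rw [rightUnitor_inv_naturality_assoc, rightUnitor_inv_naturality_assoc, ← whisker_exchange_assoc,
    ← whisker_exchange_assoc, MonObj.mul_assoc]
  simp only [tensorHom_def', whiskerLeft_comp, Category.assoc]
  monoidal

variable [BraidedCategory C]

/-- The maps h ⊗ x ↦ h₁ ⊗ S(h₂)x and h ⊗ x ↦ h₁ ⊗ h₂x are inverse, one antipode axiom for each
order. -/
lemma isIso_shear {H X : C} [HopfObj H] (a : H ⊗ X ⟶ X)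
    (ha : μ[H] ▷ X ≫ a = (α_ H H X).hom ≫ H ◁ a ≫ a) (ha' : η[H] ▷ X ≫ a = (λ_ X).hom) :
    IsIso (shear (Δ[H] ≫ H ◁ 𝒮[H]) a) := by
  refine ⟨shear Δ[H] a, ?_, ?_⟩
  · rw [shear_comp_shear _ _ _ ha, ← shear_unit a ha', Category.assoc, whisker_exchange_assoc,
      associator_naturality_right_assoc, ← whiskerLeft_comp, ← ComonObj.comul_assoc_assoc,
      ← whiskerLeft_comp, HopfObj.antipode_right, whiskerLeft_comp, ComonObj.comul_counit_assoc]
  · rw [shear_comp_shear _ _ _ ha, ← shear_unit a ha', comp_whiskerRight_assoc,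
      associator_naturality_middle_assoc, ← whiskerLeft_comp, ← ComonObj.comul_assoc_assoc,
      ← whiskerLeft_comp, HopfObj.antipode_left, whiskerLeft_comp, ComonObj.comul_counit_assoc]

/-- A group-like s has the two-sided inverse S(s). -/
lemma isIso_mulRight {H : C} [HopfObj H] (s : 𝟙_ C ⟶ H) (hε : s ≫ ε[H] = 𝟙 _)
    (hΔ : s ≫ Δ[H] = (λ_ (𝟙_ C)).inv ≫ (s ⊗ₘ s)) : IsIso (mulRight s) := by
  have h₁ : mulRight η[H] = 𝟙 H := by simp [mulRight]
  refine ⟨mulRight (s ≫ 𝒮[H]), ?_, ?_⟩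
  · have h := s ≫= HopfObj.antipode_right H
    rw [reassoc_of% hΔ, reassoc_of% hε] at h
    rw [mulRight_comp, ← h₁, ← h]
    simp only [MonoidalCategory.tensorHom_def, whiskerLeft_comp, Category.assoc]
  · have h := s ≫= HopfObj.antipode_left H
    rw [reassoc_of% hΔ, reassoc_of% hε] at h
    rw [mulRight_comp, ← h₁, ← h]
    simp only [tensorHom_def', comp_whiskerRight, Category.assoc]

/-- With h the twisted first factor, S(h)·(x ⊗ s) = S(h₂)x ⊗ S(h₁)s: a shear, then S on the
remaining leg, a crossing and multiplication by s. -/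
lemma whiskerLeft_insert_tensAct {H X : C} [HopfObj H] {d : H ⟶ 𝟙_ C} (a : H ⊗ X ⟶ X)
    (s : 𝟙_ C ⟶ H) :
    (twistedAntipode d ⊗ₘ ((ρ_ X).inv ≫ X ◁ s)) ≫ tensAct a μ[H] =
      twist d ▷ X ≫ shear (Δ[H] ≫ H ◁ 𝒮[H]) a ≫ 𝒮[H] ▷ X ≫ (β_ H X).hom ≫ X ◁ mulRight s := by
  have h₁ := tensorμ_natural_right H H (𝟙 X) s
  have h₂ : twistedAntipode d ≫ Δ[H] =
      twist d ≫ Δ[H] ≫ H ◁ 𝒮[H] ≫ 𝒮[H] ▷ H ≫ (β_ H H).hom := by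
    rw [twistedAntipode_eq, Category.assoc, HopfObj.antipode_comul,
      ← BraidedCategory.braiding_naturality, tensorHom_def'_assoc]
  have h₃ : (β_ H H).hom ▷ X ≫ (α_ H H X).hom ≫ H ◁ (β_ H X).hom ≫ (α_ H X H).inv ≫ a ▷ H =
      (α_ H H X).hom ≫ H ◁ a ≫ (β_ H X).hom := by
    rw [BraidedCategory.braiding_naturality_right, BraidedCategory.braiding_tensor_right_hom]
    simp
  simp only [id_tensorHom, whiskerLeft_id] at h₁
  rw [MonoidalCategory.tensorHom_def, tensAct, Category.assoc, whisker_exchange_assoc,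
    ← comp_whiskerRight_assoc, h₂, whiskerLeft_comp_assoc, reassoc_of% h₁,
    reassoc_of% tensorμ_unit_right, MonoidalCategory.tensorHom_def]
  simp only [comp_whiskerRight, Category.assoc, whisker_exchange_assoc, reassoc_of% h₃, shear,
    mulRight, whiskerLeft_comp]
  rw [← comp_whiskerRight_assoc (𝒮[H] ▷ H), ← whisker_exchange, comp_whiskerRight_assoc,
    associator_naturality_left_assoc]

end Shear

/-! ### The simplicial relations. -/

section Simplicial

variable {C : Type u} [Category.{v} C] [MonoidalCategory C] {H : C}

lemma unit_whiskerRight_naturality [MonObj H] {X Y : C} (f : X ⟶ Y) :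
    ((λ_ X).inv ≫ η[H] ▷ X) ≫ H ◁ f = f ≫ (λ_ Y).inv ≫ η[H] ▷ Y := by
  rw [Category.assoc, ← whisker_exchange, leftUnitor_inv_naturality_assoc]

section Comon

variable [ComonObj H]

/-- The cofaces of positive index, by recursion on the degree. -/
def cofaceSucc (s : 𝟙_ C ⟶ H) : (n : ℕ) → Fin (n + 1) → (tpow H n ⟶ tpow H (n + 1))
  | 0, _ => s ≫ (ρ_ H).inv
  | n + 1, i => Fin.cases (Δ[H] ▷ tpow H n ≫ (α_ H H (tpow H n)).hom)
      (fun k => H ◁ cofaceSucc s n k) i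

variable (s : 𝟙_ C ⟶ H)

lemma cofaceSucc_castSucc (n : ℕ) (l : Fin n) : cofaceSucc s n l.castSucc = comulAt H n l := by
  induction n with
  | zero => exact l.elim0
  | succ n ih =>
    induction l using Fin.cases with
    | zero => rfl
    | succ l => exact congrArg (H ◁ ·) (ih l)

lemma cofaceSucc_last (n : ℕ) : cofaceSucc s n (Fin.last n) = insertLast s n := by
  induction n with
  | zero => rfl
  | succ n ih => exact congrArg (H ◁ ·) ih

/-- The recursive form peels off only the first factor, and treats the insertion of σ as the base
case, so that the relations can be proved by induction. -/
lemma coface_succ [MonObj H] (n : ℕ) (k : Fin (n + 1)) :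
    coface s n k.succ = cofaceSucc s n k := by
  change Fin.lastCases (motive := fun _ => tpow H n ⟶ tpow H (n + 1)) (insertLast s n)
    (fun l => comulAt H n l) k = _
  induction k using Fin.lastCases with
  | last => rw [Fin.lastCases_last, cofaceSucc_last]
  | cast l => rw [Fin.lastCases_castSucc, cofaceSucc_castSucc]

lemma counitAt_zero (n : ℕ) :
    counitAt H n 0 = ε[H] ▷ tpow H n ≫ (λ_ (tpow H n)).hom := by
  cases n <;> rfl

lemma comul_whiskerRight_naturality {X Y : C} (f : X ⟶ Y) :
    H ◁ f ≫ Δ[H] ▷ Y ≫ (α_ H H Y).hom = (Δ[H] ▷ X ≫ (α_ H H X).hom) ≫ H ◁ H ◁ f := by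
  rw [whisker_exchange_assoc]
  monoidal

lemma counit_whiskerRight_naturality {X Y : C} (f : X ⟶ Y) :
    H ◁ f ≫ ε[H] ▷ Y ≫ (λ_ Y).hom = (ε[H] ▷ X ≫ (λ_ X).hom) ≫ f := by
  rw [whisker_exchange_assoc, leftUnitor_naturality, Category.assoc]

lemma comul_whiskerRight_coassoc (X : C) :
    (Δ[H] ▷ X ≫ (α_ H H X).hom) ≫ H ◁ (Δ[H] ▷ X ≫ (α_ H H X).hom) =
      (Δ[H] ▷ X ≫ (α_ H H X).hom) ≫ Δ[H] ▷ (H ⊗ X) ≫ (α_ H H (H ⊗ X)).hom := by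
  rw [Category.assoc, whiskerLeft_comp, ← associator_naturality_middle_assoc,
    ← comp_whiskerRight_assoc, ComonObj.comul_assoc]
  monoidal

lemma unit_whiskerRight_comul [MonObj H]
    (hη : η[H] ≫ Δ[H] = (λ_ (𝟙_ C)).inv ≫ (η[H] ⊗ₘ η[H])) (X : C) :
    ((λ_ X).inv ≫ η[H] ▷ X) ≫ Δ[H] ▷ X ≫ (α_ H H X).hom =
      ((λ_ X).inv ≫ η[H] ▷ X) ≫ (λ_ (H ⊗ X)).inv ≫ η[H] ▷ (H ⊗ X) := by
  rw [Category.assoc, ← comp_whiskerRight_assoc, hη, tensorHom_def']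
  monoidal

/-- Coassociativity when both indices are at the head, interchange when only one is, and
group-likeness of σ at the end of the recursion. -/
lemma cofaceSucc_cofaceSucc (hs : s ≫ Δ[H] = (λ_ (𝟙_ C)).inv ≫ (s ⊗ₘ s)) (n : ℕ)
    (i j : Fin (n + 1)) (hij : i ≤ j) :
    cofaceSucc s n i ≫ cofaceSucc s (n + 1) j.succ =
      cofaceSucc s n j ≫ cofaceSucc s (n + 1) i.castSucc := by
  induction n with
  | zero =>
    obtain rfl : i = 0 := Fin.fin_one_eq_zero i
    obtain rfl : j = 0 := Fin.fin_one_eq_zero j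
    change (s ≫ (ρ_ H).inv) ≫ H ◁ (s ≫ (ρ_ H).inv) =
      (s ≫ (ρ_ H).inv) ≫ Δ[H] ▷ 𝟙_ C ≫ (α_ H H (𝟙_ C)).hom
    rw [Category.assoc, Category.assoc, rightUnitor_inv_naturality_assoc,
      rightUnitor_inv_naturality_assoc, ← comp_whiskerRight_assoc, hs]
    simp [MonoidalCategory.tensorHom_def, unitors_inv_equal]
  | succ n ih =>
    induction i using Fin.cases with
    | zero =>
      induction j using Fin.cases with
      | zero => exact comul_whiskerRight_coassoc (tpow H n)
      | succ j => exact (comul_whiskerRight_naturality (cofaceSucc s n j)).symm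
    | succ i =>
      induction j using Fin.cases with
      | zero => simp at hij
      | succ j =>
        have h := ih i j (by simpa using hij)
        exact (whiskerLeft_comp ..).symm.trans ((congrArg (H ◁ ·) h).trans (whiskerLeft_comp ..))

lemma counitAt_counitAt (n : ℕ) (i j : Fin (n + 1)) (hij : i ≤ j) :
    counitAt H (n + 1) i.castSucc ≫ counitAt H n j =
      counitAt H (n + 1) j.succ ≫ counitAt H n i := by
  induction n with
  | zero =>
    obtain rfl : i = 0 := Fin.fin_one_eq_zero i
    obtain rfl : j = 0 := Fin.fin_one_eq_zero j
    exact (counit_whiskerRight_naturality _).symm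
  | succ n ih =>
    induction i using Fin.cases with
    | zero => exact (counit_whiskerRight_naturality _).symm
    | succ i =>
      induction j using Fin.cases with
      | zero => simp at hij
      | succ j =>
        have h := ih i j (by simpa using hij)
        exact (whiskerLeft_comp ..).symm.trans ((congrArg (H ◁ ·) h).trans (whiskerLeft_comp ..))

lemma cofaceSucc_counitAt_of_lt (n : ℕ) (i : Fin (n + 2)) (j : Fin (n + 1)) (hij : i ≤ j.castSucc) :
    cofaceSucc s (n + 2) i.castSucc ≫ counitAt H (n + 2) j.succ.succ =
      counitAt H (n + 1) j.succ ≫ cofaceSucc s (n + 1) i := by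
  induction n with
  | zero =>
    obtain rfl : j = 0 := Fin.fin_one_eq_zero j
    obtain rfl : i = 0 := by simpa using hij
    exact (comul_whiskerRight_naturality _).symm
  | succ n ih =>
    induction i using Fin.cases with
    | zero => exact (comul_whiskerRight_naturality _).symm
    | succ i =>
      induction j using Fin.cases with
      | zero => simp at hij
      | succ j =>
        have h := ih i j (by simpa [Fin.le_def] using hij)
        exact (whiskerLeft_comp ..).symm.trans ((congrArg (H ◁ ·) h).trans (whiskerLeft_comp ..))

lemma cofaceSucc_castSucc_counitAt_succ (n : ℕ) (k : Fin (n + 1)) :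
    cofaceSucc s (n + 1) k.castSucc ≫ counitAt H (n + 1) k.succ = 𝟙 (tpow H (n + 1)) := by
  have h (n : ℕ) : (Δ[H] ▷ tpow H n ≫ (α_ H H (tpow H n)).hom) ≫
      H ◁ (ε[H] ▷ tpow H n ≫ (λ_ (tpow H n)).hom) = 𝟙 (H ⊗ tpow H n) := by
    rw [Category.assoc, whiskerLeft_comp, ← associator_naturality_middle_assoc,
      ← comp_whiskerRight_assoc, ComonObj.comul_counit]
    monoidal
  induction n with
  | zero =>
    obtain rfl : k = 0 := Fin.fin_one_eq_zero k
    exact h 0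
  | succ n ih =>
    induction k using Fin.cases with
    | zero => exact h (n + 1)
    | succ k =>
      exact (whiskerLeft_comp ..).symm.trans ((congrArg (H ◁ ·) (ih k)).trans (whiskerLeft_id ..))

lemma cofaceSucc_counitAt_self (hs : s ≫ ε[H] = 𝟙 (𝟙_ C)) (n : ℕ) (k : Fin (n + 1)) :
    cofaceSucc s n k ≫ counitAt H n k = 𝟙 (tpow H n) := by
  induction n with
  | zero =>
    obtain rfl : k = 0 := Fin.fin_one_eq_zero k
    change (s ≫ (ρ_ H).inv) ≫ ε[H] ▷ 𝟙_ C ≫ (λ_ (𝟙_ C)).hom = 𝟙 (𝟙_ C)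
    rw [Category.assoc, ← rightUnitor_inv_naturality_assoc, reassoc_of% hs]
    simp [unitors_equal]
  | succ n ih =>
    induction k using Fin.cases with
    | zero =>
      change (Δ[H] ▷ tpow H n ≫ (α_ H H (tpow H n)).hom) ≫ ε[H] ▷ (H ⊗ tpow H n) ≫
        (λ_ (H ⊗ tpow H n)).hom = 𝟙 (H ⊗ tpow H n)
      rw [Category.assoc, ← associator_naturality_left_assoc, ← comp_whiskerRight_assoc,
        ComonObj.counit_comul]
      monoidal
    | succ k =>
      exact (whiskerLeft_comp ..).symm.trans ((congrArg (H ◁ ·) (ih k)).trans (whiskerLeft_id ..))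

lemma cofaceSucc_counitAt_of_gt (n : ℕ) (i j : Fin (n + 1)) (hij : j ≤ i) :
    cofaceSucc s (n + 1) i.succ ≫ counitAt H (n + 1) j.castSucc =
      counitAt H n j ≫ cofaceSucc s n i := by
  induction n with
  | zero =>
    obtain rfl : i = 0 := Fin.fin_one_eq_zero i
    obtain rfl : j = 0 := Fin.fin_one_eq_zero j
    exact counit_whiskerRight_naturality _
  | succ n ih =>
    induction j using Fin.cases with
    | zero => exact counit_whiskerRight_naturality _
    | succ j =>
      induction i using Fin.cases with
      | zero => simp at hij
      | succ i =>
        have h := ih i j (by simpa using hij)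
        exact (whiskerLeft_comp ..).symm.trans ((congrArg (H ◁ ·) h).trans (whiskerLeft_comp ..))

end Comon

variable [MonObj H] [ComonObj H] (s : 𝟙_ C ⟶ H)

lemma coface_coface (hη : η[H] ≫ Δ[H] = (λ_ (𝟙_ C)).inv ≫ (η[H] ⊗ₘ η[H]))
    (hs : s ≫ Δ[H] = (λ_ (𝟙_ C)).inv ≫ (s ⊗ₘ s)) (n : ℕ) (i j : Fin (n + 2)) (hij : i ≤ j) :
    coface s n i ≫ coface s (n + 1) j.succ = coface s n j ≫ coface s (n + 1) i.castSucc := by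
  induction i using Fin.cases with
  | zero =>
    induction j using Fin.cases with
    | zero =>
      rw [coface_succ]
      exact unit_whiskerRight_comul hη (tpow H n)
    | succ j =>
      rw [coface_succ, coface_succ]
      exact unit_whiskerRight_naturality (cofaceSucc s n j)
  | succ i =>
    induction j using Fin.cases with
    | zero => simp at hij
    | succ j =>
      rw [coface_succ, coface_succ, coface_succ, ← Fin.succ_castSucc, coface_succ]
      exact cofaceSucc_cofaceSucc s hs n i j (by simpa using hij)

lemma coface_counitAt_of_le (n : ℕ) (i : Fin (n + 2)) (j : Fin (n + 1)) (hij : i ≤ j.castSucc) :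
    coface s (n + 1) i.castSucc ≫ counitAt H (n + 1) j.succ = counitAt H n j ≫ coface s n i := by
  induction i using Fin.cases with
  | zero => exact unit_whiskerRight_naturality (counitAt H n j)
  | succ i =>
    induction j using Fin.cases with
    | zero => simp at hij
    | succ j =>
      cases n with
      | zero => exact j.elim0
      | succ n =>
        rw [coface_succ, ← Fin.succ_castSucc, coface_succ]
        exact cofaceSucc_counitAt_of_lt s n i j (by simpa [Fin.le_def] using hij)

lemma coface_counitAt_self (hη : η[H] ≫ ε[H] = 𝟙 (𝟙_ C)) (n : ℕ) (j : Fin (n + 1)) :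
    coface s n j.castSucc ≫ counitAt H n j = 𝟙 (tpow H n) := by
  induction j using Fin.cases with
  | zero =>
    rw [counitAt_zero]
    change ((λ_ (tpow H n)).inv ≫ η[H] ▷ tpow H n) ≫ ε[H] ▷ tpow H n ≫ (λ_ (tpow H n)).hom = _
    rw [Category.assoc, ← comp_whiskerRight_assoc, hη]
    simp
  | succ j =>
    cases n with
    | zero => exact j.elim0
    | succ n =>
      rw [← Fin.succ_castSucc, coface_succ]
      exact cofaceSucc_castSucc_counitAt_succ s n j

lemma coface_counitAt_of_gt (n : ℕ) (i : Fin (n + 2)) (j : Fin (n + 1)) (hij : j.castSucc < i) :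
    coface s (n + 1) i.succ ≫ counitAt H (n + 1) j.castSucc = counitAt H n j ≫ coface s n i := by
  induction i using Fin.cases with
  | zero => simp at hij
  | succ i =>
    rw [coface_succ, coface_succ]
    exact cofaceSucc_counitAt_of_gt s n i j (by
      simp only [Fin.lt_def, Fin.le_def, Fin.val_castSucc, Fin.val_succ] at *
      omega)

end Simplicial

/-! ### Equivariance of the structure maps. -/

section Cyclic

variable {C : Type u} [Category.{v} C] [MonoidalCategory C]

/-- The isomorphism moving the last factor of `H^{⊗ n} ⊗ H` into the tensor power. -/
def tpowSnoc (H : C) : (n : ℕ) → (tpow H n ⊗ H ≅ tpow H (n + 1))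
  | 0 => λ_ H ≪≫ (ρ_ H).symm
  | n + 1 => α_ H (tpow H n) H ≪≫ whiskerLeftIso H (tpowSnoc H n)

/-- Exhibits the target as X ⊗ H, the shape required by the factorisation of τ. -/
lemma insertLast_eq {H : C} (s : 𝟙_ C ⟶ H) (n : ℕ) :
    insertLast s n = ((ρ_ (tpow H n)).inv ≫ tpow H n ◁ s) ≫ (tpowSnoc H n).hom := by
  induction n with
  | zero =>
    change s ≫ (ρ_ H).inv = ((ρ_ (𝟙_ C)).inv ≫ 𝟙_ C ◁ s) ≫ (λ_ H).hom ≫ (ρ_ H).inv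
    rw [Category.assoc, leftUnitor_naturality_assoc, unitors_equal, Iso.inv_hom_id_assoc]
  | succ n ih =>
    change H ◁ insertLast s n = ((ρ_ (H ⊗ tpow H n)).inv ≫ (H ⊗ tpow H n) ◁ s) ≫
      (α_ H (tpow H n) H).hom ≫ H ◁ (tpowSnoc H n).hom
    rw [ih]
    monoidal

variable [BraidedCategory C]

section Bimon

variable {H : C} [BimonObj H]

lemma comul_whiskerRight_equivariant {X : C} (a : H ⊗ X ⟶ X) :
    H ◁ (Δ[H] ▷ X ≫ (α_ H H X).hom) ≫ tensAct μ[H] (tensAct μ[H] a) =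
      tensAct μ[H] a ≫ Δ[H] ▷ X ≫ (α_ H H X).hom := by
  rw [whiskerLeft_comp_assoc, associator_tensAct,
    reassoc_of% (whiskerRight_tensAct μ[H] a _ Δ[H] comul_tensAct)]

lemma counit_whiskerRight_equivariant {X : C} (a : H ⊗ X ⟶ X) :
    H ◁ (ε[H] ▷ X ≫ (λ_ X).hom) ≫ a = tensAct μ[H] a ≫ ε[H] ▷ X ≫ (λ_ X).hom := by
  rw [whiskerLeft_comp_assoc, leftUnitor_tensAct,
    reassoc_of% (whiskerRight_tensAct μ[H] a _ ε[H] counit_equivariant)]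

lemma one_diagAct (n : ℕ) : η[H] ▷ tpow H n ≫ diagAct H n = (λ_ (tpow H n)).hom := by
  induction n with
  | zero =>
    change η[H] ▷ 𝟙_ C ≫ (ρ_ H).hom ≫ ε[H] = (λ_ (𝟙_ C)).hom
    rw [rightUnitor_naturality_assoc, BimonObj.one_counit, Category.comp_id, unitors_equal]
  | succ n ih => exact one_tensAct μ[H] (diagAct H n) (MonObj.one_mul H) ih

lemma mul_diagAct (n : ℕ) :
    μ[H] ▷ tpow H n ≫ diagAct H n =
      (α_ H H (tpow H n)).hom ≫ H ◁ diagAct H n ≫ diagAct H n := by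
  induction n with
  | zero =>
    change μ[H] ▷ 𝟙_ C ≫ (ρ_ H).hom ≫ ε[H] =
      (α_ H H (𝟙_ C)).hom ≫ H ◁ ((ρ_ H).hom ≫ ε[H]) ≫ (ρ_ H).hom ≫ ε[H]
    rw [rightUnitor_naturality_assoc, ← counit_equivariant]
    monoidal
  | succ n ih => exact mul_tensAct μ[H] (diagAct H n) (MonObj.mul_assoc H) ih

lemma counitAt_equivariant (n : ℕ) (j : Fin (n + 1)) :
    H ◁ counitAt H n j ≫ diagAct H n = diagAct H (n + 1) ≫ counitAt H n j := by
  induction n with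
  | zero => exact counit_whiskerRight_equivariant (diagAct H 0)
  | succ n ih =>
    induction j using Fin.cases with
    | zero => exact counit_whiskerRight_equivariant (diagAct H (n + 1))
    | succ j => exact whiskerLeft_tensAct μ[H] (diagAct H (n + 1)) (diagAct H n) _ (ih j)

/-- The index stops short of the last coface: inserting σ is not H-linear in general. -/
lemma cofaceSucc_equivariant (s : 𝟙_ C ⟶ H) (n : ℕ) (i : Fin (n + 1)) :
    H ◁ cofaceSucc s (n + 1) i.castSucc ≫ diagAct H (n + 2) =
      diagAct H (n + 1) ≫ cofaceSucc s (n + 1) i.castSucc := by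
  induction n with
  | zero =>
    obtain rfl : i = 0 := Fin.fin_one_eq_zero i
    exact comul_whiskerRight_equivariant (diagAct H 0)
  | succ n ih =>
    induction i using Fin.cases with
    | zero => exact comul_whiskerRight_equivariant (diagAct H (n + 1))
    | succ i => exact whiskerLeft_tensAct μ[H] (diagAct H (n + 1)) (diagAct H (n + 2)) _ (ih i)

lemma tpowSnoc_equivariant (n : ℕ) :
    H ◁ (tpowSnoc H n).hom ≫ diagAct H (n + 1) =
      tensAct (diagAct H n) μ[H] ≫ (tpowSnoc H n).hom := by
  induction n with
  | zero =>
    change H ◁ ((λ_ H).hom ≫ (ρ_ H).inv) ≫ tensAct μ[H] ((ρ_ H).hom ≫ ε[H]) =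
      tensAct ((ρ_ H).hom ≫ ε[H]) μ[H] ≫ (λ_ H).hom ≫ (ρ_ H).inv
    rw [← reassoc_of% leftUnitor_tensAct, whiskerLeft_comp_assoc]
    congr 1
    rw [← cancel_mono (ρ_ H).hom, Category.assoc, ← rightUnitor_tensAct]
    simp
  | succ n ih =>
    have h₁ := associator_tensAct μ[H] (diagAct H n) μ[H]
    have h₂ := whiskerLeft_tensAct μ[H] _ _ _ ih
    change H ◁ ((α_ H (tpow H n) H).hom ≫ H ◁ (tpowSnoc H n).hom) ≫
      tensAct μ[H] (diagAct H (n + 1)) = tensAct (tensAct μ[H] (diagAct H n)) μ[H] ≫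
        (α_ H (tpow H n) H).hom ≫ H ◁ (tpowSnoc H n).hom
    rw [whiskerLeft_comp_assoc]
    exact (congrArg (H ◁ (α_ H (tpow H n) H).hom ≫ ·) h₂).trans (by
      simp only [reassoc_of% h₁])

end Bimon

variable {H : C} [HopfObj H] {d : H ⟶ 𝟙_ C} {s : 𝟙_ C ⟶ H}

/-- The twisted antipode of the first factor acts on the image of the second one under `t`. -/
def twistedAct {X Y : C} (d : H ⟶ 𝟙_ C) (t : X ⟶ Y) (a : H ⊗ Y ⟶ Y) : H ⊗ X ⟶ Y :=
  twistedAntipode d ▷ X ≫ H ◁ t ≫ a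

lemma cyc_succ (n : ℕ) :
    cyc d s (n + 1) = twistedAct d (insertLast s n) (diagAct H (n + 1)) := by
  change (twistedAntipode d ⊗ₘ insertLast s n) ≫ diagAct H (n + 1) = _
  rw [MonoidalCategory.tensorHom_def, Category.assoc, twistedAct]

/-! ### The twisted action on an arbitrary object. -/

section TwistedAct

variable {X Y X' Y' : C}

lemma unit_twistedAct (hη : η[H] ≫ d = 𝟙 (𝟙_ C)) (t : X ⟶ Y) (a : H ⊗ Y ⟶ Y)
    (ha : η[H] ▷ Y ≫ a = (λ_ Y).hom) :
    ((λ_ X).inv ≫ η[H] ▷ X) ≫ twistedAct d t a = t := by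
  rw [twistedAct, Category.assoc, ← comp_whiskerRight_assoc, one_twistedAntipode hη,
    ← whisker_exchange_assoc, ha, leftUnitor_naturality, Iso.inv_hom_id_assoc]

lemma comul_twistedAct (t : X ⟶ Y) (a : H ⊗ Y ⟶ Y) :
    (Δ[H] ▷ X ≫ (α_ H H X).hom) ≫ twistedAct d (H ◁ t) (tensAct μ[H] a) =
      twistedAct d t a ≫ (λ_ Y).inv ≫ η[H] ▷ Y := by
  have h := comul_twistedAntipode_tensAct (d := d) a
  rw [twistedAct, ← whisker_exchange_assoc, Category.assoc,
    ← reassoc_of% (comul_whiskerRight_naturality (H := H) t), h, whisker_exchange_assoc]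
  simp only [twistedAct, Category.assoc]

/-- Carries every cyclic relation that leaves the first factor alone: only g has to be H-linear. -/
lemma twistedAct_naturality (t : X ⟶ Y) (t' : X' ⟶ Y') (a : H ⊗ Y ⟶ Y) (a' : H ⊗ Y' ⟶ Y')
    (f : X ⟶ X') (g : Y ⟶ Y') (ht : t ≫ g = f ≫ t') (hg : H ◁ g ≫ a' = a ≫ g) :
    H ◁ f ≫ twistedAct d t' a' = twistedAct d t a ≫ g := by
  simp only [twistedAct, Category.assoc]
  rw [whisker_exchange_assoc, ← hg, ← whiskerLeft_comp_assoc, ← ht, whiskerLeft_comp_assoc]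

lemma twistedAct_twistedAct (hη : η[H] ≫ d = 𝟙 (𝟙_ C))
    (hμ : μ[H] ≫ d = (d ⊗ₘ d) ≫ (λ_ (𝟙_ C)).hom) (t : X ⟶ Y) (a : H ⊗ Y ⟶ Y)
    (ha : μ[H] ▷ Y ≫ a = (α_ H H Y).hom ≫ H ◁ a ≫ a) (ha' : η[H] ▷ Y ≫ a = (λ_ Y).hom) :
    twistedAct d (H ◁ t) (tensAct μ[H] a) ≫ twistedAct d (𝟙 Y) a =
      (ε[H] ▷ (H ⊗ X) ≫ (λ_ (H ⊗ X)).hom) ≫ twistedAct d t a := by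
  simp only [twistedAct, Category.assoc, whiskerLeft_id, Category.id_comp]
  rw [tensAct_twistedAntipode a ha ha' hμ, whisker_exchange_assoc, ← comp_whiskerRight_assoc,
    twistedAntipode_self hη hμ, leftUnitor_naturality_assoc, whisker_exchange_assoc]

lemma isIso_twistedAct (hS : IsIso 𝒮[H]) (hη : η[H] ≫ d = 𝟙 (𝟙_ C))
    (hμ : μ[H] ≫ d = (d ⊗ₘ d) ≫ (λ_ (𝟙_ C)).hom) (hε : s ≫ ε[H] = 𝟙 (𝟙_ C))
    (hΔ : s ≫ Δ[H] = (λ_ (𝟙_ C)).inv ≫ (s ⊗ₘ s)) (a : H ⊗ X ⟶ X) (b : H ⊗ Y ⟶ Y)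
    (ha : μ[H] ▷ X ≫ a = (α_ H H X).hom ≫ H ◁ a ≫ a) (ha' : η[H] ▷ X ≫ a = (λ_ X).hom)
    (e : X ⊗ H ≅ Y) (he : H ◁ e.hom ≫ b = tensAct a μ[H] ≫ e.hom) :
    IsIso (twistedAct d (((ρ_ X).inv ≫ X ◁ s) ≫ e.hom) b) := by
  have := isIso_twist hη hμ
  have := isIso_shear a ha ha'
  have := isIso_mulRight s hε hΔ
  have h : twistedAct d (((ρ_ X).inv ≫ X ◁ s) ≫ e.hom) b =
      (twist d ▷ X ≫ shear (Δ[H] ≫ H ◁ 𝒮[H]) a ≫ 𝒮[H] ▷ X ≫ (β_ H X).hom ≫ X ◁ mulRight s) ≫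
        e.hom := by
    rw [← whiskerLeft_insert_tensAct, twistedAct, whiskerLeft_comp_assoc, he,
      MonoidalCategory.tensorHom_def]
    simp only [Category.assoc]
  rw [h]
  infer_instance

end TwistedAct

/-! ### The paracyclic relations. -/

lemma isIso_cyc (hS : IsIso 𝒮[H]) (hη : η[H] ≫ d = 𝟙 (𝟙_ C))
    (hμ : μ[H] ≫ d = (d ⊗ₘ d) ≫ (λ_ (𝟙_ C)).hom) (hε : s ≫ ε[H] = 𝟙 (𝟙_ C))
    (hΔ : s ≫ Δ[H] = (λ_ (𝟙_ C)).inv ≫ (s ⊗ₘ s)) (n : ℕ) : IsIso (cyc d s n) := by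
  cases n with
  | zero => exact inferInstanceAs (IsIso (𝟙 (𝟙_ C)))
  | succ n =>
    rw [cyc_succ, insertLast_eq]
    exact isIso_twistedAct hS hη hμ hε hΔ (diagAct H n) (diagAct H (n + 1)) (mul_diagAct n)
      (one_diagAct n) (tpowSnoc H n) (tpowSnoc_equivariant n)

lemma coface_zero_cyc (hη : η[H] ≫ d = 𝟙 (𝟙_ C)) (n : ℕ) :
    coface s n 0 ≫ cyc d s (n + 1) = coface s n (Fin.last (n + 1)) := by
  rw [cyc_succ, ← Fin.succ_last, coface_succ, cofaceSucc_last]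
  exact unit_twistedAct hη (insertLast s n) (diagAct H (n + 1)) (one_diagAct (n + 1))

/-- Group-likeness rewrites σ ⊗ σ as Δσ, so S̃(σ)σ = δ(σ)1 = 1. -/
lemma insertLast_cyc_one (hsd : s ≫ d = 𝟙 (𝟙_ C))
    (hΔ : s ≫ Δ[H] = (λ_ (𝟙_ C)).inv ≫ (s ⊗ₘ s)) :
    insertLast s 0 ≫ cyc d s 1 = insertUnit H 0 := by
  have h : (s ≫ (ρ_ H).inv) ≫ H ◁ (s ≫ (ρ_ H).inv) =
      (s ≫ (ρ_ H).inv) ≫ Δ[H] ▷ 𝟙_ C ≫ (α_ H H (𝟙_ C)).hom :=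
    cofaceSucc_cofaceSucc s hΔ 0 0 0 le_rfl
  have h' := comul_twistedAntipode_tensAct (d := d) ((ρ_ H).hom ≫ ε[H])
  change (s ≫ (ρ_ H).inv) ≫ (twistedAntipode d ⊗ₘ (s ≫ (ρ_ H).inv)) ≫
    tensAct μ[H] ((ρ_ H).hom ≫ ε[H]) = (λ_ (𝟙_ C)).inv ≫ η[H] ▷ 𝟙_ C
  rw [tensorHom_def'_assoc, ← Category.assoc, h, Category.assoc, Category.assoc, Category.assoc, h',
    Category.assoc, rightUnitor_naturality_assoc,
    Iso.inv_hom_id_assoc, reassoc_of% twistedAntipode_counit, reassoc_of% hsd]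

lemma cofaceSucc_cyc (hsd : s ≫ d = 𝟙 (𝟙_ C))
    (hΔ : s ≫ Δ[H] = (λ_ (𝟙_ C)).inv ≫ (s ⊗ₘ s)) (n : ℕ) (i : Fin (n + 1)) :
    cofaceSucc s n i ≫ cyc d s (n + 1) = cyc d s n ≫ coface s n i.castSucc := by
  cases n with
  | zero =>
    obtain rfl : i = 0 := Fin.fin_one_eq_zero i
    exact (insertLast_cyc_one hsd hΔ).trans (Category.id_comp _).symm
  | succ n =>
    rw [cyc_succ, cyc_succ]
    induction i using Fin.cases with
    | zero => exact comul_twistedAct (insertLast s n) (diagAct H (n + 1))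
    | succ i =>
      -- Commutation with the insertion of σ; for the top index it says that comultiplying the
      -- inserted σ inserts it twice.
      have h := cofaceSucc_cofaceSucc s hΔ n i (Fin.last n) (Fin.le_last i)
      rw [Fin.succ_last, cofaceSucc_last, cofaceSucc_last] at h
      rw [← Fin.succ_castSucc, coface_succ]
      exact twistedAct_naturality (insertLast s n) (insertLast s (n + 1)) (diagAct H (n + 1))
        (diagAct H (n + 2)) (cofaceSucc s n i) (cofaceSucc s (n + 1) i.castSucc) h.symm
        (cofaceSucc_equivariant s n i)

lemma counitAt_cyc (n : ℕ) (i : Fin n) :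
    counitAt H n i.succ ≫ cyc d s n = cyc d s (n + 1) ≫ counitAt H n i.castSucc := by
  cases n with
  | zero => exact i.elim0
  | succ n =>
    have h := cofaceSucc_counitAt_of_gt s n (Fin.last n) i (Fin.le_last i)
    rw [Fin.succ_last, cofaceSucc_last, cofaceSucc_last] at h
    rw [cyc_succ, cyc_succ]
    exact twistedAct_naturality (insertLast s (n + 1)) (insertLast s n) (diagAct H (n + 2))
      (diagAct H (n + 1)) (counitAt H n i) (counitAt H (n + 1) i.castSucc) h
      (counitAt_equivariant (n + 1) i.castSucc)

/-- The last counit is H-linear and cancels the inserted σ, leaving S̃(x)·y; this simplifies the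
outer half of τ². -/
lemma cyc_counitAt_last (hε : s ≫ ε[H] = 𝟙 (𝟙_ C)) (n : ℕ) :
    cyc d s (n + 1) ≫ counitAt H n (Fin.last n) = twistedAct d (𝟙 (tpow H n)) (diagAct H n) := by
  have h := cofaceSucc_counitAt_self s hε n (Fin.last n)
  rw [cofaceSucc_last] at h
  rw [cyc_succ, ← Category.id_comp (twistedAct d (𝟙 (tpow H n)) (diagAct H n)), ← whiskerLeft_id]
  exact (twistedAct_naturality (insertLast s n) (𝟙 (tpow H n)) (diagAct H (n + 1)) (diagAct H n)
    (𝟙 (tpow H n)) (counitAt H n (Fin.last n)) (h.trans (Category.id_comp _).symm)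
    (counitAt_equivariant n (Fin.last n))).symm

lemma counitAt_zero_cyc (hη : η[H] ≫ d = 𝟙 (𝟙_ C))
    (hμ : μ[H] ≫ d = (d ⊗ₘ d) ≫ (λ_ (𝟙_ C)).hom) (hsd : s ≫ d = 𝟙 (𝟙_ C))
    (hε : s ≫ ε[H] = 𝟙 (𝟙_ C)) (n : ℕ) :
    counitAt H n 0 ≫ cyc d s n =
      cyc d s (n + 1) ≫ cyc d s (n + 1) ≫ counitAt H n (Fin.last n) := by
  rw [cyc_counitAt_last hε]
  cases n with
  | zero =>
    -- Here τ_0 is an identity, not a twisted action; the claim becomes δ(S̃(x)σ) = δ(S̃(x))δ(σ) =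
    -- ε(x).
    change (ε[H] ▷ 𝟙_ C ≫ (λ_ (𝟙_ C)).hom) ≫ 𝟙 (𝟙_ C) =
      ((twistedAntipode d ⊗ₘ (s ≫ (ρ_ H).inv)) ≫ tensAct μ[H] ((ρ_ H).hom ≫ ε[H])) ≫
        twistedAntipode d ▷ 𝟙_ C ≫ H ◁ 𝟙 (𝟙_ C) ≫ (ρ_ H).hom ≫ ε[H]
    rw [whiskerLeft_id, Category.id_comp, rightUnitor_naturality_assoc, twistedAntipode_counit,
      Category.comp_id, Category.assoc, ← reassoc_of% rightUnitor_tensAct, hμ, ← id_tensorHom,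
      tensorHom_comp_tensorHom_assoc, tensorHom_comp_tensorHom_assoc]
    simp [twistedAntipode_self hη hμ, hsd]
  | succ n =>
    rw [counitAt_zero, cyc_succ, cyc_succ]
    exact (twistedAct_twistedAct hη hμ (insertLast s n) (diagAct H (n + 1)) (mul_diagAct (n + 1))
      (one_diagAct (n + 1))).symm

end Cyclic

end BraidedCM

theorem mainTheorem6 {C : Type u} [Category.{v} C] [MonoidalCategory C] [BraidedCategory C]
    (H : C) [HopfObj H] (hS : IsIso 𝒮[H]) (p : BraidedCM.ModularPair H) :
    BraidedCM.IsParacocyclic (BraidedCM.CM H p) := by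
  have hη : η[H] ≫ p.δ = 𝟙 (𝟙_ C) := p.isMonHom_δ.one_hom
  have hμ : μ[H] ≫ p.δ = (p.δ ⊗ₘ p.δ) ≫ (λ_ (𝟙_ C)).hom := p.isMonHom_δ.mul_hom
  have hε : p.σ ≫ ε[H] = 𝟙 (𝟙_ C) := p.isComonHom_σ.hom_counit
  have hΔ : p.σ ≫ Δ[H] = (λ_ (𝟙_ C)).inv ≫ (p.σ ⊗ₘ p.σ) := p.isComonHom_σ.hom_comul
  exact
    { cyc_isIso := BraidedCM.isIso_cyc hS hη hμ hε hΔ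
      coface_coface := BraidedCM.coface_coface p.σ (Bimon.one_comul H) hΔ
      codegen_codegen := BraidedCM.counitAt_counitAt
      coface_codegen_of_le := BraidedCM.coface_counitAt_of_le p.σ
      coface_codegen_self := BraidedCM.coface_counitAt_self p.σ (BimonObj.one_counit H)
      coface_codegen_succ := fun n j =>
        (congrArg (· ≫ BraidedCM.counitAt H n j) (BraidedCM.coface_succ p.σ n j)).trans
          (BraidedCM.cofaceSucc_counitAt_self p.σ hε n j)
      coface_codegen_of_gt := BraidedCM.coface_counitAt_of_gt p.σ
      coface_succ_cyc := fun n i =>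
        (congrArg (· ≫ BraidedCM.cyc p.δ p.σ (n + 1)) (BraidedCM.coface_succ p.σ n i)).trans
          (BraidedCM.cofaceSucc_cyc p.σ_δ hΔ n i)
      coface_zero_cyc := BraidedCM.coface_zero_cyc hη
      codegen_succ_cyc := BraidedCM.counitAt_cyc
      codegen_zero_cyc := BraidedCM.counitAt_zero_cyc hη hμ p.σ_δ hε }
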